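/- **Proposition 3.15 (Energy balance, functions).** Let $\Omega\subset\mathbb R^m$ be a bounded domain with smooth boundary and $\mathcal B=\overline\Omega$; let $dx$ be Lebesgue measure on $\mathcal B$ and $ds$ the area element of $\partial\mathcal B$. Let $V=C^\infty(\mathcal B)$ (functions on $\mathcal B$ that extend smoothly to $\mathbb R^m$, with the Fréchet topology), $V^\star=C^\infty(\mathcal B)\times C^\infty(\partial\mathcal B)$ the restricted dual, with pairing $$\langle(\alpha,\alpha_\partial),\varphi\rangle=\int_{\mathcal B}\alpha\varphi\,dx+\int_{\partial\mathcal B}\alpha_\partial\varphi\,ds,$$ and $TV=V\times V$, $T^\star V=V\times V^\star$. An element of $V^\star$ is identified, through the pairing, with a functional on $V$. Let $\mathfrak L:\mathbb R\times\mathbb R\times\mathbb R^m\to\mathbb R$ be smooth and let $L(\varphi,\nu)=\int_{\mathcal B}\mathfrak L(\varphi,\nu,\nabla\varphi)\,dx$ be the associated Lagrangian, with partial functional derivatives $$\frac{\delta L}{\delta\varphi}(\varphi,\nu)(\delta\varphi)=\frac{d}{d\epsilon}\Big|_{\epsilon=0}L(\varphi+\epsilon\,\delta\varphi,\nu),\qquad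 \frac{\delta L}{\delta\nu}(\varphi,\nu)(\delta\nu)=\frac{d}{d\epsilon}\Big|_{\epsilon=0}L(\varphi,\nu+\epsilon\,\delta\nu).$$ Let $\mathcal F:TV\to C^\infty(\mathcal B)$ and $\mathcal F_\partial:TV\to C^\infty(\partial\mathcal B)$ be arbitrary maps (body force and boundary force). The Dirac differential of $L$ is the covector $$\mathrm d_DL(\varphi,\nu)=\Big(\varphi,\frac{\delta L}{\delta\nu}(\varphi,\nu),-\frac{\delta L}{\delta\varphi}(\varphi,\nu),\nu\Big)$$ and the Lagrangian force field is the covector $$\widetilde F(\varphi,\nu)=\Big(\varphi,\frac{\delta L}{\delta\nu}(\varphi,\nu),(\mathcal F(\varphi,\nu),\mathcal F_\partial(\varphi,\nu)),0\Big);$$ both have the base point $(\varphi,\frac{\delta L}{\delta\nu}(\varphi,\nu))$, and their difference is taken in the fibre. Let $D_{T^\star V}$ be the canonical Dirac structure on $T^\star V$, i.e. the graph of the flat map of the canonical symplectic form $-\mathrm d\Theta$, where $\Theta(\varphi,\alpha,\alpha_\partial)\cdot(\delta\varphi,\delta\alpha,\delta\alpha_\partial)=\langle(\alpha,\alpha_\partial),\delta\varphi\rangle$.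 Let $(\varphi,\nu,\alpha,\alpha_\partial):[t_0,t_1]\to TV\oplus T^\star V$ be a differentiable curve that solves the Lagrange–Dirac system with body and boundary forces, that is, for all $t\in[t_0,t_1]$, $$\big((\varphi,\alpha,\alpha_\partial,\dot\varphi,\dot\alpha,\dot\alpha_\partial),\ \mathrm d_DL(\varphi,\nu)-\widetilde F(\varphi,\nu)\big)\in D_{T^\star V}(\varphi,\alpha,\alpha_\partial).$$ Let $\mathfrak E=\frac{\partial\mathfrak L}{\partial\nu}\,\nu-\mathfrak L$ be the energy density. Then at every $t\in[t_0,t_1]$ (with one-sided time derivatives at the end points) the following derivatives exist and satisfy the local energy balance, at every point of $\mathcal B$, $$\frac{\partial}{\partial t}\mathfrak E(\varphi,\nu,\nabla\varphi)=-\operatorname{div}\Big(\frac{\partial\mathfrak L}{\partial\nabla\varphi}(\varphi,\nu,\nabla\varphi)\,\nu\Big)+\mathcal F(\varphi,\nu)\,\nu,$$ and the global energy balance $$\frac{d}{dt}\int_{\mathcal B}\mathfrak E(\varphi,\nu,\nabla\varphi)\,dx=\int_{\mathcal B}\mathcal F(\varphi,\nu)\,\nu\,dx+\int_{\partial\mathcal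 B}\mathcal F_\partial(\varphi,\nu)\,\nu\,ds.$$ -/

import Mathlib

open Set Filter Topology MeasureTheory
open scoped ContDiff

namespace LagrangeDirac

/-! ## Domains and spaces of smooth functions -/

/-- Euclidean space `ℝᵐ`. -/
abbrev Euc (m : ℕ) : Type := EuclideanSpace ℝ (Fin m)

/-- Bounded domains with smooth boundary: bounded connected open sets which near each boundary
point are the sublevel set `{ρ < 0}` of a smooth function `ρ` with `dρ ≠ 0` at that point. -/
structure IsSmoothBoundedDomain {m : ℕ} (Ω : Set (Euc m)) : Prop where
  isOpen : IsOpen Ω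
  isConnected : IsConnected Ω
  isBounded : Bornology.IsBounded Ω
  smooth_boundary : ∀ p ∈ frontier Ω, ∃ U ∈ 𝓝 p, ∃ ρ : Euc m → ℝ,
    ContDiff ℝ ∞ ρ ∧ fderiv ℝ ρ p ≠ 0 ∧ ∀ x ∈ U, (x ∈ Ω ↔ ρ x < 0)

section SmoothFunctions

variable {m : ℕ} {F : Type} [NormedAddCommGroup F] [NormedSpace ℝ F]

/-- The space `C^∞(ℝᵐ, F)`. -/
def SmoothMap (m : ℕ) (F : Type) [NormedAddCommGroup F] [NormedSpace ℝ F] : Type :=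
  {g : Euc m → F // ContDiff ℝ ∞ g}

/-- The `n`-th derivative of a smooth map, as a continuous map. -/
noncomputable def SmoothMap.iteratedDeriv (n : ℕ) (g : SmoothMap m F) : C(Euc m, Euc m [×n]→L[ℝ] F) :=
  ⟨iteratedFDeriv ℝ n g.1, g.2.continuous_iteratedFDeriv (by exact_mod_cast le_top)⟩

/-- The Fréchet topology of `C^∞(ℝᵐ, F)`: uniform convergence on compact sets of the derivatives
of every order (`C(_, _)` carries the compact-open topology). -/
noncomputable instance : TopologicalSpace (SmoothMap m F) :=
  ⨅ n : ℕ, TopologicalSpace.induced (SmoothMap.iteratedDeriv n) inferInstance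

/-- The functions on `S` which are restrictions of smooth functions on `ℝᵐ`. -/
def smoothSubmodule (S : Set (Euc m)) (F : Type) [NormedAddCommGroup F] [NormedSpace ℝ F] :
    Submodule ℝ (S → F) where
  carrier := {f | ∃ g : Euc m → F, ContDiff ℝ ∞ g ∧ ∀ x : S, g x = f x}
  zero_mem' := ⟨0, contDiff_const, fun _ => rfl⟩
  add_mem' := by
    rintro f f' ⟨g, hg, h⟩ ⟨g', hg', h'⟩
    exact ⟨g + g', hg.add hg', fun x => by simp [h, h']⟩
  smul_mem' := by
    rintro c f ⟨g, hg, h⟩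
    exact ⟨c • g, contDiff_const.smul hg, fun x => by simp [h]⟩

/-- `C^∞(S, F)`: the functions on `S` that extend to smooth functions on `ℝᵐ`. It is used for
`S = closure Ω` and, in the case of the closed smooth hypersurface `S = ∂Ω`, gives exactly the
smooth functions on that hypersurface. -/
def SmoothFun (S : Set (Euc m)) (F : Type) [NormedAddCommGroup F] [NormedSpace ℝ F] : Type :=
  smoothSubmodule S F

variable {S : Set (Euc m)}

instance : AddCommGroup (SmoothFun S F) := inferInstanceAs (AddCommGroup (smoothSubmodule S F))
instance : Module ℝ (SmoothFun S F) := inferInstanceAs (Module ℝ (smoothSubmodule S F))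
instance : FunLike (SmoothFun S F) S F := ⟨fun f => f.1, fun _ _ h => Subtype.ext h⟩

/-- The function `f` on `S` as an element of `C^∞(S, F)`, given a smooth extension `g`. -/
def SmoothFun.mk (f : S → F) (g : Euc m → F) (hg : ContDiff ℝ ∞ g) (h : ∀ x : S, g x = f x) :
    SmoothFun S F :=
  ⟨f, g, hg, h⟩

@[simp] theorem SmoothFun.mk_apply (f : S → F) (g : Euc m → F) (hg : ContDiff ℝ ∞ g)
    (h : ∀ x : S, g x = f x) (x : S) : SmoothFun.mk f g hg h x = f x := rfl

@[simp] theorem SmoothFun.zero_apply (x : S) : (0 : SmoothFun S F) x = 0 := rfl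

@[simp] theorem SmoothFun.add_apply (f g : SmoothFun S F) (x : S) : (f + g) x = f x + g x := rfl

@[simp] theorem SmoothFun.smul_apply (c : ℝ) (f : SmoothFun S F) (x : S) :
    (c • f) x = c • f x := rfl

/-- Restriction `C^∞(ℝᵐ, F) → C^∞(S, F)`. -/
def SmoothMap.restrict (S : Set (Euc m)) (g : SmoothMap m F) : SmoothFun S F :=
  .mk (fun x => g.1 x) g.1 g.2 fun _ => rfl

/-- The Fréchet topology of `C^∞(S, F)`: the final topology of the restriction map. -/
noncomputable instance : TopologicalSpace (SmoothFun S F) :=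
  TopologicalSpace.coinduced (SmoothMap.restrict S) inferInstance

/-- A smooth extension of `f ∈ C^∞(S, F)` to `ℝᵐ`. -/
noncomputable def SmoothFun.ext (f : SmoothFun S F) : Euc m → F := Classical.choose f.2

theorem SmoothFun.contDiff_ext (f : SmoothFun S F) : ContDiff ℝ ∞ f.ext :=
  (Classical.choose_spec f.2).1

theorem SmoothFun.ext_apply (f : SmoothFun S F) (x : S) : f.ext x = f x :=
  (Classical.choose_spec f.2).2 x

/-- The derivative on `closure Ω` of a smooth function does not depend on the extension. -/
theorem SmoothFun.fderiv_ext_eq {Ω : Set (Euc m)} (hΩ : IsOpen Ω) (f : SmoothFun (closure Ω) F)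
    {g : Euc m → F} (hg : ContDiff ℝ ∞ g) (hfg : ∀ x : closure Ω, g x = f x) :
    EqOn (fderiv ℝ f.ext) (fderiv ℝ g) (closure Ω) := by
  refine EqOn.closure (fun x hx => ?_)
    (f.contDiff_ext.continuous_fderiv (by simp)) (hg.continuous_fderiv (by simp))
  refine Filter.EventuallyEq.fderiv_eq ?_
  filter_upwards [hΩ.mem_nhds hx] with y hy
  rw [f.ext_apply ⟨y, subset_closure hy⟩, ← hfg]

theorem contDiff_gradient {g : Euc m → ℝ} (hg : ContDiff ℝ ∞ g) : ContDiff ℝ ∞ (gradient g) :=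
  (InnerProductSpace.toDual ℝ (Euc m)).symm.toContinuousLinearEquiv.contDiff.comp
    (hg.fderiv_right (by simp))

/-- The gradient `∇ : C^∞(B) → C^∞(B, ℝᵐ)`. -/
noncomputable def grad (f : SmoothFun S ℝ) : SmoothFun S (Euc m) :=
  .mk (fun x => gradient f.ext x) (gradient f.ext) (contDiff_gradient f.contDiff_ext) fun _ => rfl

/-- The divergence `div : C^∞(B, ℝᵐ) → C^∞(B)`, `div X = ∑ i, ∂X^i/∂x^i`. -/
noncomputable def divergence (X : SmoothFun S (Euc m)) : SmoothFun S ℝ :=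
  .mk (fun x => ∑ i, (fderiv ℝ X.ext x (EuclideanSpace.single i 1)) i)
    (fun x => ∑ i, (fderiv ℝ X.ext x (EuclideanSpace.single i 1)) i)
    (ContDiff.sum fun i _ => (EuclideanSpace.proj (𝕜 := ℝ) i).contDiff.comp
      ((X.contDiff_ext.fderiv_right (m := ∞) (by simp)).clm_apply contDiff_const))
    fun _ => rfl

end SmoothFunctions

/-- `c'` is the velocity at `t` of the curve `c` in the topological vector space `X`, the
parameter being restricted to `I`. -/
def HasVelocityWithinAt {X : Type} [AddCommGroup X] [Module ℝ X] [TopologicalSpace X]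
    (c : ℝ → X) (c' : X) (I : Set ℝ) (t : ℝ) : Prop :=
  Tendsto (slope c t) (𝓝[I \ {t}] t) (𝓝 c')

/-! ## Restricted dual, canonical forms, canonical Dirac structure -/

section Dirac

variable {m : ℕ} (Ω : Set (Euc m))

/-- The configuration space `V = C^∞(B)`, where `B = closure Ω`. -/
abbrev V : Type := SmoothFun (closure Ω) ℝ

/-- `C^∞(∂B)`. -/
abbrev BdryFun : Type := SmoothFun (frontier Ω) ℝ

/-- The restricted dual `V⋆ = C^∞(B) × C^∞(∂B)`. -/
abbrev RDual : Type := V Ω × BdryFun Ω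

/-- The restricted cotangent bundle `T⋆V = V × V⋆`, which is also the model of its tangent
spaces. -/
abbrev RCot : Type := V Ω × RDual Ω

/-- The tangent bundle `T(T⋆V)`: pairs of a base point and a tangent vector. -/
abbrev TRCot : Type := RCot Ω × RCot Ω

/-- The restricted cotangent bundle `T⋆(T⋆V)`: pairs of a base point and a covector in
`V⋆ × V`. -/
abbrev RCotRCot : Type := RCot Ω × (RDual Ω × V Ω)

/-- Functionals on `V`. -/
abbrev Functional : Type := V Ω → ℝ

variable {Ω}

/-- The integral over `B` with respect to the Lebesgue measure `dx`. -/
noncomputable def bodyIntegral (f : closure Ω → ℝ) : ℝ :=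
  ∫ x, f x ∂((volume : Measure (Euc m)).comap Subtype.val)

/-- The area element of `∂B`: the normalized `(m - 1)`-dimensional Hausdorff measure. -/
noncomputable def area (Ω : Set (Euc m)) : Measure (frontier Ω) :=
  (Measure.euclideanHausdorffMeasure (m - 1) : Measure (Euc m)).comap Subtype.val

/-- The integral over `∂B` of the product of a function on `∂B` with one on `B`. -/
noncomputable def bdryIntegral (f : BdryFun Ω) (φ : V Ω) : ℝ :=
  ∫ x, f x * φ ⟨x, frontier_subset_closure x.2⟩ ∂(area Ω)

/-- The pairing `⟨(α, α∂), φ⟩ = ∫_B α φ dx + ∫_∂B α∂ φ ds` of `V⋆` with `V`. As a functional of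
`φ` it gives the identification `Ψ` of `V⋆` with a space of functionals on `V`. -/
noncomputable def pairing (a : RDual Ω) : Functional Ω := fun φ =>
  bodyIntegral (fun x => a.1 x * φ x) + bdryIntegral a.2 φ

/-- The pairing of a covector in `V⋆ × V` with a tangent vector of `T⋆V`. -/
noncomputable def pairingRCot (ζ : RDual Ω × V Ω) (w : RCot Ω) : ℝ :=
  pairing ζ.1 w.1 + pairing w.2 ζ.2

/-- The canonical one-form `Θ(z) · δz = ⟨z, Tπ(δz)⟩` on `T⋆V`. -/
noncomputable def canonicalOneForm (z w : RCot Ω) : ℝ := pairing z.2 w.1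

/-- The canonical symplectic form `-dΘ` on `T⋆V`; the exterior derivative is evaluated on the
constant vector fields `u` and `w`. -/
noncomputable def symplecticForm (z u w : RCot Ω) : ℝ :=
  -(deriv (fun t : ℝ => canonicalOneForm (z + t • u) w) 0
    - deriv (fun t : ℝ => canonicalOneForm (z + t • w) u) 0)

/-- The canonical Dirac structure on `T⋆V` at `z`: the graph of the flat map of the symplectic
form, inside the fibre over `z` of the restricted Pontryagin bundle `T(T⋆V) ⊕ T⋆(T⋆V)`. -/
def canonicalDirac (z : RCot Ω) : Set (TRCot Ω × RCotRCot Ω) :=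
  {p | p.1.1 = z ∧ p.2.1 = z ∧ ∀ w : RCot Ω, pairingRCot p.2.2 w = symplecticForm z p.1.2 w}

/-! ## Lagrangians, forces, Lagrange–Dirac systems -/

/-- The point values `(φ(x), ν(x), ∇φ(x))`. -/
noncomputable def jet (φ ν : V Ω) (x : closure Ω) : ℝ × ℝ × Euc m := (φ x, ν x, grad φ x)

/-- The Lagrangian `L(φ, ν) = ∫_B 𝔏(φ, ν, ∇φ) dx` on `TV = V × V`. -/
noncomputable def lagrangian (𝔏 : ℝ × ℝ × Euc m → ℝ) (q : V Ω × V Ω) : ℝ :=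
  bodyIntegral fun x => 𝔏 (jet q.1 q.2 x)

/-- The partial functional derivative `δL/δφ`. -/
noncomputable def derivPhi (L : V Ω × V Ω → ℝ) (q : V Ω × V Ω) : Functional Ω := fun δφ =>
  deriv (fun ε : ℝ => L (q.1 + ε • δφ, q.2)) 0

/-- The partial functional derivative `δL/δν`. -/
noncomputable def derivNu (L : V Ω × V Ω → ℝ) (q : V Ω × V Ω) : Functional Ω := fun δν =>
  deriv (fun ε : ℝ => L (q.1, q.2 + ε • δν)) 0

/-- The differential `dL(φ, ν) = (φ, ν, δL/δφ, δL/δν)`. -/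
noncomputable def differential (L : V Ω × V Ω → ℝ) (q : V Ω × V Ω) :
    (V Ω × V Ω) × (Functional Ω × Functional Ω) :=
  (q, (derivPhi L q, derivNu L q))

/-- The isomorphism `γ : (φ, φ̇, a, b) ↦ (φ, b, -a, φ̇)` of the Tulczyjew triple. The covectors
`a`, `b` are in a space `A` of duals of `V`: the restricted dual, or functionals on `V`. -/
def gammaMap {A : Type} [Neg A] (ξ : (V Ω × V Ω) × (A × A)) : (V Ω × A) × (A × V Ω) :=
  ((ξ.1.1, ξ.2.2), (-ξ.2.1, ξ.1.2))

/-- The Dirac differential `d_D L = γ ∘ dL`. -/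
noncomputable def diracDifferential (L : V Ω × V Ω → ℝ) (q : V Ω × V Ω) :
    (V Ω × Functional Ω) × (Functional Ω × V Ω) :=
  gammaMap (differential L q)

/-- The Legendre transform `FL(φ, ν) = (φ, δL/δν)`. -/
noncomputable def legendre (L : V Ω × V Ω → ℝ) (q : V Ω × V Ω) : V Ω × Functional Ω :=
  (q.1, derivNu L q)

/-- The Lagrangian force field `F̃` of the force `F = (φ, 𝓕, 𝓕∂)`: the covector at `FL(φ, ν)`
with `⟨F̃(φ, ν), W⟩ = ⟨F(φ, ν), Tπ(W)⟩`, i.e. with components `(𝓕, 𝓕∂)` and `0`. -/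
noncomputable def forceField (L : V Ω × V Ω → ℝ) (𝓕 : V Ω × V Ω → V Ω)
    (𝓕b : V Ω × V Ω → BdryFun Ω) (q : V Ω × V Ω) :
    (V Ω × Functional Ω) × (Functional Ω × V Ω) :=
  (legendre L q, (pairing (𝓕 q, 𝓕b q), 0))

/-- The covector `d_D L(φ, ν) - F̃(φ, ν)`: both terms lie over the base point `FL(φ, ν)`, and the
difference is taken in the fibre. -/
noncomputable def forcedDiracDifferential (L : V Ω × V Ω → ℝ) (𝓕 : V Ω × V Ω → V Ω)
    (𝓕b : V Ω × V Ω → BdryFun Ω) (q : V Ω × V Ω) :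
    (V Ω × Functional Ω) × (Functional Ω × V Ω) :=
  (legendre L q, (diracDifferential L q).2 - (forceField L 𝓕 𝓕b q).2)

/-- The identification of `T⋆(T⋆V) = V × V⋆ × V⋆ × V` with a set of quadruples whose second and
third entries are functionals on `V`, through `V⋆ ∋ a ↦ ⟨a, ·⟩`. -/
noncomputable def toFunctionals (η : RCotRCot Ω) : (V Ω × Functional Ω) × (Functional Ω × V Ω) :=
  ((η.1.1, pairing η.1.2), (pairing η.2.1, η.2.2))

/-- The curve `(φ, ν, α, α∂)` on `[t₀, t₁]` in `TV ⊕ T⋆V` is differentiable and solves the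
Lagrange–Dirac system with body and boundary forces, that is
`((φ, α, α∂, φ̇, α̇, α̇∂), d_D L(φ, ν) - F̃(φ, ν)) ∈ D(φ, α, α∂)`. -/
def IsLagrangeDiracSolution (L : V Ω × V Ω → ℝ) (𝓕 : V Ω × V Ω → V Ω)
    (𝓕b : V Ω × V Ω → BdryFun Ω) (t₀ t₁ : ℝ)
    (φ ν α : ℝ → V Ω) (αb : ℝ → BdryFun Ω) : Prop :=
  ∀ t ∈ Icc t₀ t₁, ∃ (φ' ν' α' : V Ω) (αb' : BdryFun Ω),
    HasVelocityWithinAt φ φ' (Icc t₀ t₁) t ∧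
    HasVelocityWithinAt ν ν' (Icc t₀ t₁) t ∧
    HasVelocityWithinAt α α' (Icc t₀ t₁) t ∧
    HasVelocityWithinAt αb αb' (Icc t₀ t₁) t ∧
    ∃ η : RCotRCot Ω,
      toFunctionals η = forcedDiracDifferential L 𝓕 𝓕b (φ t, ν t) ∧
      (((φ t, α t, αb t), (φ', α', αb')), η) ∈ canonicalDirac (φ t, α t, αb t)

/-! ## Energy -/

/-- The partial derivative `∂𝔏/∂ν`. -/
noncomputable def partialNu (𝔏 : ℝ × ℝ × Euc m → ℝ) (p : ℝ × ℝ × Euc m) : ℝ :=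
  deriv (fun r => 𝔏 (p.1, r, p.2.2)) p.2.1

/-- The partial derivative `∂𝔏/∂∇φ`. -/
noncomputable def partialGrad (𝔏 : ℝ × ℝ × Euc m → ℝ) (p : ℝ × ℝ × Euc m) : Euc m :=
  gradient (fun w => 𝔏 (p.1, p.2.1, w)) p.2.2

theorem contDiff_partialGrad {𝔏 : ℝ × ℝ × Euc m → ℝ} (h𝔏 : ContDiff ℝ ∞ 𝔏) :
    ContDiff ℝ ∞ (partialGrad 𝔏) := by
  refine (InnerProductSpace.toDual ℝ (Euc m)).symm.toContinuousLinearEquiv.contDiff.comp ?_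
  refine ContDiff.fderiv (n := ∞) (f := fun (p : ℝ × ℝ × Euc m) (w : Euc m) => 𝔏 (p.1, p.2.1, w))
    (g := fun p => p.2.2) (m := ∞) ?_ (by fun_prop) (by simp)
  exact h𝔏.comp (by fun_prop)

/-- The energy density `𝔈 = (∂𝔏/∂ν) ν - 𝔏`. -/
noncomputable def energyDensity (𝔏 : ℝ × ℝ × Euc m → ℝ) (p : ℝ × ℝ × Euc m) : ℝ :=
  partialNu 𝔏 p * p.2.1 - 𝔏 p

/-- The vector field `(∂𝔏/∂∇φ)(φ, ν, ∇φ) ν` on `B`. -/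
noncomputable def energyFlux {𝔏 : ℝ × ℝ × Euc m → ℝ} (h𝔏 : ContDiff ℝ ∞ 𝔏) (φ ν : V Ω) :
    SmoothFun (closure Ω) (Euc m) :=
  .mk (fun x => ν x • partialGrad 𝔏 (jet φ ν x))
    (fun y => ν.ext y • partialGrad 𝔏 (φ.ext y, ν.ext y, gradient φ.ext y))
    (ν.contDiff_ext.smul ((contDiff_partialGrad h𝔏).comp
      (φ.contDiff_ext.prodMk (ν.contDiff_ext.prodMk (contDiff_gradient φ.contDiff_ext)))))
    fun x => by rw [φ.ext_apply, ν.ext_apply]; rfl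

end Dirac

end LagrangeDirac

/-! Since `α = ∂𝔏/∂ν` along a solution, the energy density equals `αν - 𝔏`. When it is
differentiated in time the `ν̇` terms cancel, and with `φ̇ = ν` there remains `α̇ν - (∂𝔏/∂φ)ν -
⟨∂𝔏/∂∇φ, ∇ν⟩`. Both balances come from inserting the momentum equation `⟨(α̇, α̇∂), w⟩ = δL/δφ(w) +
⟨(𝓕, 𝓕∂), w⟩`, used with two kinds of `w`.

Local balance: for `w` compactly supported in `Ω`, integration by parts over `ℝᵐ` has no boundary
term. The fundamental lemma of the calculus of variations then gives the Euler–Lagrange equation on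
`Ω`, and by continuity on its closure (`momentum_balance`). The product rule for the divergence
(`divergence_energyFlux`) finishes.

Global balance: take `w = ν`. The boundary force enters directly through the pairing, so the
divergence theorem on `Ω` is never used. The term with `α̇∂` drops out: the Legendre relation makes
`α∂` vanish as a functional at all times (`legendre_relation`), hence so does its velocity
(`bdryIntegral_velocity_eq_zero`).

Analytically, velocities in the Fréchet topology are sent by the continuous linear maps `f ↦ f` and
`f ↦ ∇f` to derivatives in Banach spaces of continuous functions on `B`. There superposition
operators are differentiable (`hasFDerivAt_superposition`) and integrals are bounded functionals.
For the boundary integral this requires finite area, which follows from a local estimate on regular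
zero sets (`exists_nhds_measure_zeroSet_lt_top`). -/

namespace LagrangeDirac

/-! ### Superposition operators and integration on `C(X, E)` for compact `X`. -/

section ContinuousMaps

variable {X : Type*} [TopologicalSpace X] [CompactSpace X]
  {E F : Type*} [NormedAddCommGroup E] [NormedSpace ℝ E] [NormedAddCommGroup F] [NormedSpace ℝ F]

/-- Pointwise application of a continuous family of linear maps, as a linear map between spaces of
continuous functions. -/
noncomputable def pointwiseApply (A : C(X, E →L[ℝ] F)) : C(X, E) →L[ℝ] C(X, F) :=
  LinearMap.mkContinuous
    { toFun := fun v => ⟨fun x => A x (v x), A.continuous.clm_apply v.continuous⟩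
      map_add' := fun v w => by ext x; simp
      map_smul' := fun c v => by ext x; simp } ‖A‖ fun v => by
    refine (ContinuousMap.norm_le _ (by positivity)).2 fun x => ?_
    exact (A x).le_of_opNorm_le_of_le (A.norm_coe_le_norm x) (v.norm_coe_le_norm x)

@[simp] theorem pointwiseApply_apply (A : C(X, E →L[ℝ] F)) (v : C(X, E)) (x : X) :
    pointwiseApply A v x = A x (v x) := rfl

/-- The superposition operator `u ↦ e ∘ u` of a continuously differentiable map is Fréchet
differentiable for the uniform norm. -/
theorem hasFDerivAt_superposition {e : E → F} (he : ContDiff ℝ 1 e) (u : C(X, E)) :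
    HasFDerivAt (fun v : C(X, E) => (ContinuousMap.mk e he.continuous).comp v)
      (pointwiseApply ((ContinuousMap.mk _ (he.continuous_fderiv one_ne_zero)).comp u)) u := by
  rw [hasFDerivAt_iff_isLittleO_nhds_zero, Asymptotics.isLittleO_iff]
  intro ε hε
  have hK : IsCompact (range u) := isCompact_range u.continuous
  -- Continuity of the derivative is uniform along the compact range of `u`, so one `δ` serves all
  -- `x`.
  have hunif := hK.uniformContinuousAt_of_continuousAt (fderiv ℝ e)
    (fun y _ => (he.continuous_fderiv one_ne_zero).continuousAt) (Metric.dist_mem_uniformity hε)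
  obtain ⟨δ, hδ, hδ'⟩ := Metric.mem_uniformity_dist.1 hunif
  filter_upwards [Metric.ball_mem_nhds (0 : C(X, E)) hδ] with v hv
  refine (ContinuousMap.norm_le _ (by positivity)).2 fun x => ?_
  have hvx : ‖v x‖ < δ := (v.norm_coe_le_norm x).trans_lt (by simpa using hv)
  -- Mean value inequality on the ball for `e` minus its linearization at `u x`, whose derivative
  -- has norm at most `ε` there.
  have key := (convex_ball (u x) δ).norm_image_sub_le_of_norm_hasFDerivWithin_le'
    (f := e) (f' := fderiv ℝ e) (φ := fderiv ℝ e (u x)) (C := ε) (x := u x) (y := u x + v x)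
    (fun y _ => ((he.differentiable one_ne_zero) y).hasFDerivAt.hasFDerivWithinAt)
    (fun y hy => by
      have := hδ' (a := u x) (b := y) (by rwa [dist_comm]) (mem_range_self x)
      rw [← dist_eq_norm, dist_comm]
      exact le_of_lt this)
    (Metric.mem_ball_self hδ) (by simpa [Metric.mem_ball, dist_eq_norm] using hvx)
  rw [add_sub_cancel_left] at key
  exact key.trans (by gcongr; exact v.norm_coe_le_norm x)

theorem hasDerivWithinAt_superposition {e : E → F} (he : ContDiff ℝ 1 e) {u : ℝ → C(X, E)}
    {u' : C(X, E)} {I : Set ℝ} {t : ℝ} (hu : HasDerivWithinAt u u' I t) :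
    HasDerivWithinAt (fun s => (ContinuousMap.mk e he.continuous).comp (u s))
      (pointwiseApply ((ContinuousMap.mk _ (he.continuous_fderiv one_ne_zero)).comp (u t)) u')
      I t :=
  (hasFDerivAt_superposition he (u t)).comp_hasDerivWithinAt t hu

variable [MeasurableSpace X] [BorelSpace X]

theorem integrable_continuousMap (μ : Measure X) [IsFiniteMeasure μ] (f : C(X, ℝ)) :
    Integrable f μ :=
  f.continuous.integrable_of_hasCompactSupport (HasCompactSupport.of_compactSpace _)

/-- Integration of continuous functions on a compact space against a finite measure. -/
noncomputable def integralC (μ : Measure X) [IsFiniteMeasure μ] : C(X, ℝ) →L[ℝ] ℝ :=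
  LinearMap.mkContinuous
    { toFun := fun f => ∫ x, f x ∂μ
      map_add' := fun f g =>
        integral_add (integrable_continuousMap μ f) (integrable_continuousMap μ g)
      map_smul' := fun c f => integral_const_mul c f } (μ.real univ) fun f => by
    rw [mul_comm]
    exact norm_integral_le_of_norm_le_const (.of_forall f.norm_coe_le_norm)

end ContinuousMaps

/-! ### Finite area of the boundary. -/

section Hypersurfaces

/-- A zero set of a smooth function has finite `(m - 1)`-dimensional measure near a regular
point. -/
theorem exists_nhds_measure_zeroSet_lt_top {m : ℕ} {ρ : Euc m → ℝ} (hρ : ContDiff ℝ ∞ ρ)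
    {p : Euc m} (hp : fderiv ℝ ρ p ≠ 0) :
    ∃ U ∈ 𝓝 p, Measure.euclideanHausdorffMeasure (m - 1) (U ∩ {x | ρ x = 0}) < ⊤ := by
  set A := fderiv ℝ ρ p with hA
  let K : Submodule ℝ (Euc m) := A.ker
  have hrank : Module.finrank ℝ K = m - 1 := by
    have h1 := LinearMap.finrank_range_add_finrank_ker (A : Euc m →ₗ[ℝ] ℝ)
    have h2 : LinearMap.range (A : Euc m →ₗ[ℝ] ℝ) = ⊤ := by
      refine LinearMap.range_eq_top.2 (LinearMap.surjective ?_)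
      exact fun h => hp (ContinuousLinearMap.coe_injective h)
    rw [h2, finrank_top, finrank_euclideanSpace_fin, Module.finrank_self] at h1
    have : Module.finrank ℝ K = Module.finrank ℝ (LinearMap.ker (A : Euc m →ₗ[ℝ] ℝ)) := rfl
    omega
  -- The differential together with the projection onto its kernel is injective, hence antilipschitz
  -- in finite dimension. On the zero set the first component is negligible, so the projection alone
  -- will be antilipschitz.
  let T : Euc m →L[ℝ] ℝ × K := A.prod K.orthogonalProjectionOnto
  have hT : LinearMap.ker (T : Euc m →ₗ[ℝ] ℝ × K) = ⊥ := by
    refine LinearMap.ker_eq_bot'.2 fun v hv => ?_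
    have hv' : T v = 0 := hv
    have h1 : A v = 0 := congrArg Prod.fst hv'
    have h2 : K.orthogonalProjectionOnto v = 0 := congrArg Prod.snd hv'
    have h3 : v ∈ K := h1
    rw [← Submodule.starProjection_eq_self_iff (K := K)] at h3
    rw [← h3, Submodule.starProjection_apply, h2]; rfl
  obtain ⟨c, hc, hTc⟩ := LinearMap.exists_antilipschitzWith _ hT
  -- With error `(2c)⁻¹`, two zeros `x`, `y` of `ρ` near `p` satisfy `c ‖A (x - y)‖ ≤ dist x y / 2`.
  -- If the `A` component realized the maximum in `dist (T x) (T y)`, this would force `dist x y =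
  -- 0`.
  obtain ⟨s, hs, hsρ⟩ := (hρ.contDiffAt.hasStrictFDerivAt (x := p) (by simp)).approximates_deriv_on_nhds
    (c := (2 * c)⁻¹) (Or.inr (by positivity))
  refine ⟨s ∩ Metric.ball p 1, inter_mem hs (Metric.ball_mem_nhds p one_pos), ?_⟩
  set Z := (s ∩ Metric.ball p 1) ∩ {x | ρ x = 0}
  have hbound : ∀ x ∈ Z, ∀ y ∈ Z, dist x y ≤ c * dist (K.orthogonalProjectionOnto x)
      (K.orthogonalProjectionOnto y) := by
    intro x hx y hy
    have h1 := hsρ x hx.1.1 y hy.1.1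
    rw [show ρ x = 0 from hx.2, show ρ y = 0 from hy.2, sub_zero, zero_sub, norm_neg] at h1
    have h2 := hTc.le_mul_dist x y
    have h3 : dist (T x) (T y) = max (dist (A x) (A y)) (dist (K.orthogonalProjectionOnto x)
      (K.orthogonalProjectionOnto y)) := rfl
    have h2' : dist x y ≤ c * dist (T x) (T y) := h2
    rw [h3] at h2'
    rcases max_cases (dist (A x) (A y)) (dist (K.orthogonalProjectionOnto x)
      (K.orthogonalProjectionOnto y)) with ⟨h, -⟩ | ⟨h, -⟩
    · rw [h, dist_eq_norm (A x), ← map_sub] at h2'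
      have h4 : ‖A (x - y)‖ ≤ (2 * (c : ℝ))⁻¹ * dist x y := by
        rw [dist_eq_norm]; exact_mod_cast h1
      have hc' : (0 : ℝ) < c := hc
      have h5 : (c : ℝ) * ((2 * (c : ℝ))⁻¹ * dist x y) = dist x y / 2 := by field_simp
      have h6 : dist x y ≤ dist x y / 2 := h2'.trans (h5 ▸ mul_le_mul_of_nonneg_left h4 hc'.le)
      have h7 : dist x y ≤ 0 := by linarith
      exact h7.trans (by positivity)
    · rwa [h] at h2'
  have hanti : AntilipschitzWith c (fun x : Z => K.orthogonalProjectionOnto x) :=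
    AntilipschitzWith.of_le_mul_dist fun x y => hbound x x.2 y y.2
  have hd : (0 : ℝ) ≤ ((m - 1 : ℕ) : ℝ) := by positivity
  -- The image is bounded in `K`, whose dimension is exactly `m - 1`; the unit ball was intersected
  -- in to ensure this boundedness.
  have himage : Measure.hausdorffMeasure ((m - 1 : ℕ) : ℝ)
      ((fun x : Z => K.orthogonalProjectionOnto x) '' univ) < ⊤ := by
    rw [← hrank]
    refine Bornology.IsBounded.measure_lt_top ?_
    refine (K.orthogonalProjectionOnto.lipschitz.isBounded_image
      (Metric.isBounded_ball (x := p) (r := 1))).subset ?_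
    rintro _ ⟨x, -, rfl⟩
    exact ⟨x, x.2.1.2, rfl⟩
  have hZ := hanti.le_hausdorffMeasure_image hd univ
  have hZ' : Measure.hausdorffMeasure ((m - 1 : ℕ) : ℝ) Z < ⊤ := by
    have := isometry_subtype_coe.hausdorffMeasure_image (Or.inl hd) (univ : Set Z)
    rw [image_univ, Subtype.range_coe] at this
    rw [this]
    refine hZ.trans_lt (ENNReal.mul_lt_top ?_ himage)
    exact ENNReal.rpow_lt_top_of_nonneg hd ENNReal.coe_ne_top
  rw [Measure.euclideanHausdorffMeasure_def, Measure.smul_apply, ENNReal.smul_def, smul_eq_mul]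
  exact ENNReal.mul_lt_top ENNReal.coe_lt_top hZ'

theorem IsSmoothBoundedDomain.isCompact_closure {m : ℕ} {Ω : Set (Euc m)}
    (hΩ : IsSmoothBoundedDomain Ω) : IsCompact (closure Ω) :=
  hΩ.isBounded.isCompact_closure

theorem IsSmoothBoundedDomain.isCompact_frontier {m : ℕ} {Ω : Set (Euc m)}
    (hΩ : IsSmoothBoundedDomain Ω) : IsCompact (frontier Ω) :=
  hΩ.isCompact_closure.of_isClosed_subset isClosed_frontier frontier_subset_closure

/-- The boundary of a bounded domain with smooth boundary has finite area. -/
theorem IsSmoothBoundedDomain.isFiniteMeasure_area {m : ℕ} {Ω : Set (Euc m)}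
    (hΩ : IsSmoothBoundedDomain Ω) : IsFiniteMeasure (area Ω) := by
  have hfin : Measure.euclideanHausdorffMeasure (m - 1) (frontier Ω) < ⊤ := by
    refine hΩ.isCompact_frontier.measure_lt_top_of_nhdsWithin fun p hp => ?_
    obtain ⟨U, hU, ρ, hρ, hdρ, hUρ⟩ := hΩ.smooth_boundary p hp
    obtain ⟨W, hW, hWfin⟩ := exists_nhds_measure_zeroSet_lt_top hρ hdρ
    refine ⟨(interior U ∩ W) ∩ frontier Ω, inter_mem (mem_nhdsWithin_of_mem_nhds
      (inter_mem (interior_mem_nhds.2 hU) hW)) self_mem_nhdsWithin,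
      (measure_mono ?_).trans_lt hWfin⟩
    rintro x ⟨⟨hxU, hxW⟩, hx⟩
    -- A boundary point is a limit of points with `ρ < 0`, which excludes `ρ x > 0`; it is not in
    -- the open set `Ω`, which excludes `ρ x < 0`.
    refine ⟨hxW, le_antisymm ?_ ?_⟩
    · by_contra hpos
      have h1 : ∀ᶠ y in 𝓝 x, y ∈ U ∧ 0 < ρ y :=
        Filter.Eventually.and (mem_interior_iff_mem_nhds.1 hxU)
          (hρ.continuous.continuousAt.eventually (lt_mem_nhds (not_le.1 hpos)))
      obtain ⟨y, ⟨hyU, hy⟩, hyΩ⟩ :=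
        ((mem_closure_iff_frequently.1 hx.1).and_eventually h1).exists.imp fun _ h => h.symm
      exact absurd ((hUρ y hyU).1 hyΩ) hy.not_gt
    · have h2 : x ∉ Ω := fun h => hx.2 (by rwa [hΩ.isOpen.interior_eq])
      exact not_lt.1 fun h => h2 ((hUρ x (interior_subset hxU)).2 h)
  refine ⟨?_⟩
  rw [area, comap_subtype_coe_apply isClosed_frontier.measurableSet, image_univ,
    Subtype.range_coe]
  exact hfin

end Hypersurfaces

/-! ### Continuous linear maps from `C^∞` to spaces of continuous functions. -/

section ContinuousFunctions

variable {m : ℕ} {F : Type} [NormedAddCommGroup F] [NormedSpace ℝ F] {S Ω : Set (Euc m)}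

theorem SmoothFun.continuous (f : SmoothFun S F) : Continuous f :=
  (f.contDiff_ext.continuous.comp continuous_subtype_val).congr f.ext_apply

/-- The inclusion `C^∞(S, F) → C(S, F)`. -/
def toContinuous (S : Set (Euc m)) (F : Type) [NormedAddCommGroup F] [NormedSpace ℝ F] :
    SmoothFun S F →ₗ[ℝ] C(S, F) where
  toFun f := ⟨f, f.continuous⟩
  map_add' _ _ := rfl
  map_smul' _ _ := rfl

@[simp] theorem toContinuous_apply (f : SmoothFun S F) (x : S) : toContinuous S F f x = f x := rfl

theorem continuous_iteratedDeriv (n : ℕ) :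
    Continuous (SmoothMap.iteratedDeriv n : SmoothMap m F → C(Euc m, Euc m [×n]→L[ℝ] F)) :=
  continuous_iInf_dom continuous_induced_dom

/-- For the final topology, continuity is tested on `C^∞(ℝᵐ, F)`, where the values are read off from
the derivative of order zero. -/
theorem continuous_toContinuous : Continuous (toContinuous S F) := by
  refine continuous_coinduced_dom.2 ?_
  let c0 : C(Euc m [×0]→L[ℝ] F, F) := ⟨_, (continuousMultilinearCurryFin0 ℝ (Euc m) F).continuous⟩
  let ι : C(S, Euc m) := ⟨Subtype.val, continuous_subtype_val⟩
  have h : Continuous fun g : SmoothMap m F => (c0.comp (SmoothMap.iteratedDeriv 0 g)).comp ι :=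
    (ContinuousMap.continuous_precomp ι).comp
      ((ContinuousMap.continuous_postcomp c0).comp (continuous_iteratedDeriv 0))
  exact h

theorem grad_apply_eq (hΩ : IsOpen Ω) (f : SmoothFun (closure Ω) ℝ) {g : Euc m → ℝ}
    (hg : ContDiff ℝ ∞ g) (hfg : ∀ x : closure Ω, g x = f x) (x : closure Ω) :
    grad f x = gradient g x :=
  congrArg _ (SmoothFun.fderiv_ext_eq hΩ f hg hfg x.2)

theorem gradient_add {f g : Euc m → ℝ} {x : Euc m} (hf : DifferentiableAt ℝ f x)
    (hg : DifferentiableAt ℝ g x) : gradient (f + g) x = gradient f x + gradient g x := by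
  rw [gradient, fderiv_add hf hg, map_add]; rfl

theorem gradient_smul {f : Euc m → ℝ} {x : Euc m} (c : ℝ) (hf : DifferentiableAt ℝ f x) :
    gradient (c • f) x = c • gradient f x := by
  rw [gradient, fderiv_const_smul hf c, map_smul]; rfl

/-- The gradient as a linear map `C^∞(B) → C(B, ℝᵐ)`. -/
noncomputable def gradC (hΩ : IsOpen Ω) : V Ω →ₗ[ℝ] C(closure Ω, Euc m) where
  toFun f := toContinuous _ _ (grad f)
  map_add' f g := by
    ext1 x
    have hf := f.contDiff_ext.differentiable (by simp) (x : Euc m)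
    have hg := g.contDiff_ext.differentiable (by simp) (x : Euc m)
    refine (grad_apply_eq hΩ (f + g) (f.contDiff_ext.add g.contDiff_ext) (fun y => ?_) x).trans ?_
    · simp [SmoothFun.ext_apply]
    · exact gradient_add hf hg
  map_smul' c f := by
    ext1 x
    have hf := f.contDiff_ext.differentiable (by simp) (x : Euc m)
    refine (grad_apply_eq hΩ (c • f) (f.contDiff_ext.const_smul c) (fun y => ?_) x).trans ?_
    · simp [SmoothFun.ext_apply]
    · exact gradient_smul c hf

@[simp] theorem gradC_apply (hΩ : IsOpen Ω) (f : V Ω) (x : closure Ω) :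
    gradC hΩ f x = grad f x := rfl

/-- The same argument with the derivative of order one. The chosen extension may be replaced by the
given `g`, since the gradient on `closure Ω` is independent of the extension. -/
theorem continuous_gradC (hΩ : IsOpen Ω) : Continuous (gradC hΩ) := by
  refine continuous_coinduced_dom.2 ?_
  have ⟨c1, hc1⟩ : ∃ c : C(Euc m [×1]→L[ℝ] ℝ, Euc m), ∀ A, c A =
      (InnerProductSpace.toDual ℝ (Euc m)).symm (continuousMultilinearCurryFin1 ℝ (Euc m) ℝ A) :=
    ⟨⟨_, (InnerProductSpace.toDual ℝ (Euc m)).symm.continuous.comp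
      (continuousMultilinearCurryFin1 ℝ (Euc m) ℝ).continuous⟩, fun _ => rfl⟩
  let ι : C(closure Ω, Euc m) := ⟨Subtype.val, continuous_subtype_val⟩
  have h : Continuous fun g : SmoothMap m ℝ => (c1.comp (SmoothMap.iteratedDeriv 1 g)).comp ι :=
    (ContinuousMap.continuous_precomp ι).comp
      ((ContinuousMap.continuous_postcomp c1).comp (continuous_iteratedDeriv 1))
  refine h.congr fun g => ?_
  ext1 x
  rw [Function.comp_apply, gradC_apply, grad_apply_eq hΩ _ g.2 fun _ => rfl]
  refine (hc1 _).trans (congrArg (InnerProductSpace.toDual ℝ (Euc m)).symm ?_)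
  ext v
  exact iteratedFDeriv_one_apply _

/-- Restriction to the boundary as a linear map `C^∞(B) → C(∂B)`. -/
noncomputable def traceC (Ω : Set (Euc m)) : V Ω →ₗ[ℝ] C(frontier Ω, ℝ) where
  toFun f := ⟨fun x => f ⟨x, frontier_subset_closure x.2⟩,
    f.continuous.comp (by fun_prop)⟩
  map_add' _ _ := rfl
  map_smul' _ _ := rfl

/-- The jet `(φ, ν, ∇φ)` as a continuous map, depending linearly on `(φ, ν)`. -/
noncomputable def jetC (hΩ : IsOpen Ω) (φ ν : V Ω) : C(closure Ω, ℝ × ℝ × Euc m) :=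
  (toContinuous _ _ φ).prodMk ((toContinuous _ _ ν).prodMk (gradC hΩ φ))

@[simp] theorem jetC_apply (hΩ : IsOpen Ω) (φ ν : V Ω) (x : closure Ω) :
    jetC hΩ φ ν x = jet φ ν x := rfl

/-- The jet is a sum of three bounded linear images of `φ`, `ν` and `∇φ`. The hypotheses concern
only uniform norms, so the lemma serves both solution curves and the affine lines of the functional
derivatives. -/
theorem hasDerivWithinAt_jetC [CompactSpace (closure Ω)] (hΩ : IsOpen Ω) {φ ν : ℝ → V Ω} {φ' ν' : V Ω} {I : Set ℝ} {t : ℝ}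
    (hφ : HasDerivWithinAt (fun s => toContinuous _ _ (φ s)) (toContinuous _ _ φ') I t)
    (hν : HasDerivWithinAt (fun s => toContinuous _ _ (ν s)) (toContinuous _ _ ν') I t)
    (hgrad : HasDerivWithinAt (fun s => gradC hΩ (φ s)) (gradC hΩ φ') I t) :
    HasDerivWithinAt (fun s => jetC hΩ (φ s) (ν s)) (jetC hΩ φ' ν') I t := by
  let A : C(closure Ω, ℝ) →L[ℝ] C(closure Ω, ℝ × ℝ × Euc m) :=
    (ContinuousLinearMap.inl ℝ ℝ (ℝ × Euc m)).compLeftContinuous ℝ _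
  let B : C(closure Ω, ℝ) →L[ℝ] C(closure Ω, ℝ × ℝ × Euc m) :=
    ((ContinuousLinearMap.inr ℝ ℝ (ℝ × Euc m)).comp
      (ContinuousLinearMap.inl ℝ ℝ (Euc m))).compLeftContinuous ℝ _
  let C : C(closure Ω, Euc m) →L[ℝ] C(closure Ω, ℝ × ℝ × Euc m) :=
    ((ContinuousLinearMap.inr ℝ ℝ (ℝ × Euc m)).comp
      (ContinuousLinearMap.inr ℝ ℝ (Euc m))).compLeftContinuous ℝ _
  have hjet : ∀ f g : V Ω, jetC hΩ f g
      = A (toContinuous _ _ f) + B (toContinuous _ _ g) + C (gradC hΩ f) := by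
    intro f g
    ext1 x
    simp [A, B, C, jet]
  simp only [hjet]
  exact ((A.hasFDerivAt.comp_hasDerivWithinAt t hφ).add
    (B.hasFDerivAt.comp_hasDerivWithinAt t hν)).add (C.hasFDerivAt.comp_hasDerivWithinAt t hgrad)

theorem hasDerivAt_line {X E : Type*} [AddCommGroup X] [Module ℝ X] [NormedAddCommGroup E]
    [NormedSpace ℝ E] (A : X →ₗ[ℝ] E) (x v : X) :
    HasDerivAt (fun ε : ℝ => A (x + ε • v)) (A v) 0 := by
  simp only [map_add, map_smul]
  simpa using ((hasDerivAt_id (0 : ℝ)).smul_const (A v)).const_add (A x)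

/-- A continuous linear map sends velocities in a topological vector space to derivatives. -/
theorem HasVelocityWithinAt.hasDerivWithinAt {X : Type} [AddCommGroup X] [Module ℝ X]
    [TopologicalSpace X] {E : Type*} [NormedAddCommGroup E] [NormedSpace ℝ E] {c : ℝ → X} {c' : X}
    {I : Set ℝ} {t : ℝ} (h : HasVelocityWithinAt c c' I t) (A : X →ₗ[ℝ] E) (hA : Continuous A) :
    HasDerivWithinAt (fun s => A (c s)) (A c') I t := by
  rw [hasDerivWithinAt_iff_tendsto_slope]
  refine ((hA.tendsto c').comp h).congr fun s => ?_
  simp [slope, map_sub, map_smul]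

end ContinuousFunctions

/-! ### Partial derivatives, integration by parts and the fundamental lemma. -/

section Calculus

variable {m : ℕ}

theorem fderiv_partialNu {𝔏 : ℝ × ℝ × Euc m → ℝ} (h𝔏 : ContDiff ℝ ∞ 𝔏) (p : ℝ × ℝ × Euc m)
    (b : ℝ) : fderiv ℝ 𝔏 p (0, b, 0) = partialNu 𝔏 p * b := by
  have h1 : HasFDerivAt 𝔏 (fderiv ℝ 𝔏 p) (p.1, p.2.1, p.2.2) :=
    (h𝔏.differentiable (by simp) p).hasFDerivAt
  have h2 : HasDerivAt (fun r : ℝ => (p.1, r, p.2.2)) ((0 : ℝ), (1 : ℝ), (0 : Euc m)) p.2.1 :=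
    (hasDerivAt_const _ _).prodMk ((hasDerivAt_id _).prodMk (hasDerivAt_const _ _))
  have h3 : partialNu 𝔏 p = fderiv ℝ 𝔏 p (0, 1, 0) := (h1.comp_hasDerivAt p.2.1 h2).deriv
  have h4 : ((0 : ℝ), b, (0 : Euc m)) = b • (0, 1, 0) := by simp
  rw [h3, h4, map_smul, smul_eq_mul, mul_comm]

theorem fderiv_partialGrad {𝔏 : ℝ × ℝ × Euc m → ℝ} (h𝔏 : ContDiff ℝ ∞ 𝔏) (p : ℝ × ℝ × Euc m)
    (w : Euc m) : fderiv ℝ 𝔏 p (0, 0, w) = inner ℝ (partialGrad 𝔏 p) w := by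
  have h1 : HasFDerivAt 𝔏 (fderiv ℝ 𝔏 p) (p.1, p.2.1, p.2.2) :=
    (h𝔏.differentiable (by simp) p).hasFDerivAt
  have h2 : HasFDerivAt (fun r : Euc m => (p.1, p.2.1, r))
      ((0 : Euc m →L[ℝ] ℝ).prod ((0 : Euc m →L[ℝ] ℝ).prod (.id ℝ _))) p.2.2 :=
    (hasFDerivAt_const _ _).prodMk ((hasFDerivAt_const _ _).prodMk (hasFDerivAt_id _))
  have h3 := (h1.comp p.2.2 h2).fderiv
  have h4 : inner ℝ (partialGrad 𝔏 p) w
      = fderiv ℝ (𝔏 ∘ fun r : Euc m => (p.1, p.2.1, r)) p.2.2 w := by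
    rw [partialGrad, gradient, InnerProductSpace.toDual_symm_apply]; rfl
  rw [h4, h3]; rfl

/-- The differential of a function of `(φ, ν, ∇φ)` in terms of partial derivatives. -/
theorem fderiv_eq_partials {𝔏 : ℝ × ℝ × Euc m → ℝ} (h𝔏 : ContDiff ℝ ∞ 𝔏) (p : ℝ × ℝ × Euc m)
    (a b : ℝ) (w : Euc m) : fderiv ℝ 𝔏 p (a, b, w)
      = fderiv ℝ 𝔏 p (1, 0, 0) * a + partialNu 𝔏 p * b + inner ℝ (partialGrad 𝔏 p) w := by
  have h : (a, b, w) = a • ((1 : ℝ), (0 : ℝ), (0 : Euc m)) + (0, b, 0) + (0, 0, w) := by simp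
  rw [h, map_add, map_add, map_smul, fderiv_partialNu h𝔏, fderiv_partialGrad h𝔏, smul_eq_mul,
    mul_comm a]

theorem contDiff_partialNu {𝔏 : ℝ × ℝ × Euc m → ℝ} (h𝔏 : ContDiff ℝ ∞ 𝔏) :
    ContDiff ℝ ∞ (partialNu 𝔏) := by
  have h : partialNu 𝔏 = fun p => fderiv ℝ 𝔏 p (0, 1, 0) := by
    funext p; rw [fderiv_partialNu h𝔏, mul_one]
  rw [h]
  exact (h𝔏.fderiv_right (m := ∞) (by simp)).clm_apply contDiff_const

theorem contDiff_energyDensity {𝔏 : ℝ × ℝ × Euc m → ℝ} (h𝔏 : ContDiff ℝ ∞ 𝔏) :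
    ContDiff ℝ ∞ (energyDensity 𝔏) :=
  ((contDiff_partialNu h𝔏).mul (by fun_prop)).sub h𝔏

/-- The divergence of a vector field on `ℝᵐ`. -/
noncomputable def divField (G : Euc m → Euc m) (x : Euc m) : ℝ :=
  ∑ i, (fderiv ℝ G x (EuclideanSpace.single i 1)) i

theorem contDiff_divField {G : Euc m → Euc m} (hG : ContDiff ℝ ∞ G) :
    ContDiff ℝ ∞ (divField G) :=
  ContDiff.sum fun i _ => (EuclideanSpace.proj (𝕜 := ℝ) i).contDiff.comp
    ((hG.fderiv_right (m := ∞) (by simp)).clm_apply contDiff_const)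

theorem inner_gradient_eq_sum (v : Euc m) (w : Euc m → ℝ) (x : Euc m) :
    inner ℝ v (gradient w x) = ∑ i, v i * fderiv ℝ w x (EuclideanSpace.single i 1) := by
  rw [real_inner_comm, gradient, InnerProductSpace.toDual_symm_apply]
  conv_lhs => rw [← (EuclideanSpace.basisFun (Fin m) ℝ).sum_repr v]
  simp [map_sum]

theorem divField_smul {G : Euc m → Euc m} {w : Euc m → ℝ} {x : Euc m}
    (hG : DifferentiableAt ℝ G x) (hw : DifferentiableAt ℝ w x) :
    divField (fun y => w y • G y) x = w x * divField G x + inner ℝ (G x) (gradient w x) := by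
  rw [inner_gradient_eq_sum, divField, divField, Finset.mul_sum, ← Finset.sum_add_distrib]
  refine Finset.sum_congr rfl fun i _ => ?_
  rw [fderiv_fun_smul hw hG]
  simp [mul_comm]

/-- Integration by parts against a compactly supported function. -/
theorem integral_inner_gradient {G : Euc m → Euc m} (hG : ContDiff ℝ ∞ G) {w : Euc m → ℝ}
    (hw : ContDiff ℝ ∞ w) (hwc : HasCompactSupport w) :
    ∫ x, inner ℝ (G x) (gradient w x) = -∫ x, divField G x * w x := by
  have hGi : ∀ i, ContDiff ℝ ∞ fun x => G x i := fun i =>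
    (EuclideanSpace.proj (𝕜 := ℝ) i).contDiff.comp hG
  have hGi' : ∀ i x, fderiv ℝ (fun x => G x i) x (EuclideanSpace.single i 1)
      = (fderiv ℝ G x (EuclideanSpace.single i 1)) i := fun i x => by
    have := ((EuclideanSpace.proj (𝕜 := ℝ) i).hasFDerivAt.comp x
      (hG.differentiable (by simp) x).hasFDerivAt).fderiv
    exact DFunLike.congr_fun this _
  have hcont : ∀ i, Continuous fun x => fderiv ℝ (fun x => G x i) x (EuclideanSpace.single i 1) :=
    fun i => ((hGi i).continuous_fderiv (by simp)).clm_apply continuous_const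
  have hcont' : ∀ i : Fin m, Continuous fun x => fderiv ℝ w x (EuclideanSpace.single i 1) :=
    fun i => (hw.continuous_fderiv (by simp)).clm_apply continuous_const
  have hs : ∀ i : Fin m, HasCompactSupport fun x => fderiv ℝ w x (EuclideanSpace.single i 1) :=
    fun i => hwc.fderiv_apply ℝ _
  have int1 : ∀ i, Integrable fun x => G x i * fderiv ℝ w x (EuclideanSpace.single i 1) :=
    fun i => ((hGi i).continuous.mul (hcont' i)).integrable_of_hasCompactSupport (hs i).mul_left
  have int2 : ∀ i, Integrable fun x =>
      fderiv ℝ (fun x => G x i) x (EuclideanSpace.single i 1) * w x :=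
    fun i => ((hcont i).mul hw.continuous).integrable_of_hasCompactSupport hwc.mul_left
  have int3 : ∀ i, Integrable fun x => G x i * w x :=
    fun i => ((hGi i).continuous.mul hw.continuous).integrable_of_hasCompactSupport hwc.mul_left
  simp_rw [inner_gradient_eq_sum, divField, Finset.sum_mul, ← hGi']
  rw [integral_finsetSum _ fun i _ => int1 i, integral_finsetSum _ fun i _ => int2 i,
    ← Finset.sum_neg_distrib]
  refine Finset.sum_congr rfl fun i _ => ?_
  exact integral_mul_fderiv_eq_neg_fderiv_mul_of_integrable (int2 i) (int1 i) (int3 i)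
    (fun x _ => (hGi i).differentiable (by simp) x) (fun x _ => hw.differentiable (by simp) x)

/-- A continuous function on `ℝᵐ` that is orthogonal to the test functions of the open set `Ω`
vanishes on `closure Ω`. -/
theorem eqOn_zero_of_integral_eq_zero {Ω : Set (Euc m)} (hΩ : IsOpen Ω) {f : Euc m → ℝ}
    (hf : Continuous f) (h : ∀ w : Euc m → ℝ, ContDiff ℝ ∞ w → HasCompactSupport w →
      tsupport w ⊆ Ω → ∫ x, f x * w x = 0) : EqOn f 0 (closure Ω) := by
  have hae : ∀ᵐ x, x ∈ Ω → f x = 0 :=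
    hΩ.ae_eq_zero_of_integral_contDiff_smul_eq_zero (hf.locallyIntegrable.locallyIntegrableOn _)
      fun g hg hgc hgΩ => by simpa [mul_comm] using h g hg hgc hgΩ
  refine EqOn.closure ?_ hf continuous_zero
  -- Nonempty open sets have positive Lebesgue measure, so a continuous function vanishing almost
  -- everywhere on `Ω` vanishes on all of it.
  refine Measure.eqOn_open_of_ae_eq (μ := volume) ?_ hΩ hf.continuousOn continuousOn_const
  exact (ae_restrict_iff' hΩ.measurableSet).2 hae

end Calculus

/-! ### The equations of motion, and the time derivative of the energy density. -/

section EnergyBalance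

variable {m : ℕ} {Ω : Set (Euc m)}

theorem IsSmoothBoundedDomain.compactSpace_closure (hΩ : IsSmoothBoundedDomain Ω) :
    CompactSpace (closure Ω) :=
  isCompact_iff_compactSpace.1 hΩ.isCompact_closure

theorem IsSmoothBoundedDomain.compactSpace_frontier (hΩ : IsSmoothBoundedDomain Ω) :
    CompactSpace (frontier Ω) :=
  isCompact_iff_compactSpace.1 hΩ.isCompact_frontier

theorem IsSmoothBoundedDomain.isFiniteMeasure_comap (hΩ : IsSmoothBoundedDomain Ω) :
    IsFiniteMeasure ((volume : Measure (Euc m)).comap (Subtype.val : closure Ω → Euc m)) := by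
  refine ⟨?_⟩
  rw [comap_subtype_coe_apply isClosed_closure.measurableSet, image_univ, Subtype.range_coe]
  exact hΩ.isCompact_closure.measure_lt_top

/-- The integral over `B` as a continuous linear functional on `C(B)`. -/
noncomputable def bodyC (hΩ : IsSmoothBoundedDomain Ω) :
    have := hΩ.compactSpace_closure; C(closure Ω, ℝ) →L[ℝ] ℝ :=
  haveI := hΩ.compactSpace_closure
  haveI := hΩ.isFiniteMeasure_comap
  integralC ((volume : Measure (Euc m)).comap Subtype.val)

theorem bodyC_apply (hΩ : IsSmoothBoundedDomain Ω) (f : C(closure Ω, ℝ)) :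
    bodyC hΩ f = bodyIntegral f := rfl

/-- The integral over `∂B` as a continuous linear functional on `C(∂B)`. -/
noncomputable def bdryC (hΩ : IsSmoothBoundedDomain Ω) :
    haveI := hΩ.compactSpace_frontier; C(frontier Ω, ℝ) →L[ℝ] ℝ :=
  haveI := hΩ.compactSpace_frontier
  haveI := hΩ.isFiniteMeasure_area
  integralC (area Ω)

theorem bdryIntegral_eq (hΩ : IsSmoothBoundedDomain Ω) (f : BdryFun Ω) (φ : V Ω) :
    bdryIntegral f φ = bdryC hΩ (toContinuous _ _ f * traceC Ω φ) := rfl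

/-- Exhibits the pairing through bounded functionals on `C(B)` and `C(∂B)`, so that its bilinearity
needs no separate integrability arguments. -/
theorem pairing_eq (hΩ : IsSmoothBoundedDomain Ω) (a : RDual Ω) (φ : V Ω) :
    pairing a φ = bodyC hΩ (toContinuous _ _ a.1 * toContinuous _ _ φ)
      + bdryC hΩ (toContinuous _ _ a.2 * traceC Ω φ) := rfl

theorem pairing_add_smul (hΩ : IsSmoothBoundedDomain Ω) (a b : RDual Ω) (φ : V Ω) (t : ℝ) :
    pairing (a + t • b) φ = pairing a φ + t * pairing b φ := by
  have := hΩ.compactSpace_closure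
  have := hΩ.compactSpace_frontier
  simp only [pairing_eq hΩ, Prod.fst_add, Prod.snd_add, Prod.smul_fst, Prod.smul_snd, map_add,
    map_smul, add_mul, smul_mul_assoc, smul_eq_mul]
  ring

theorem pairing_zero_left (φ : V Ω) : pairing (0 : RDual Ω) φ = 0 := by
  simp [pairing, bodyIntegral, bdryIntegral]

/-- The canonical symplectic form in canonical coordinates. -/
theorem symplecticForm_eq (hΩ : IsSmoothBoundedDomain Ω) (z u w : RCot Ω) :
    symplecticForm z u w = pairing w.2 u.1 - pairing u.2 w.1 := by
  have h : ∀ a b : RCot Ω, deriv (fun t : ℝ => canonicalOneForm (z + t • a) b) 0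
      = pairing a.2 b.1 := by
    intro a b
    simp only [canonicalOneForm, Prod.snd_add, Prod.smul_snd, pairing_add_smul hΩ]
    simp
  rw [symplecticForm, h, h]
  ring

/-- A smooth function with support in `Ω` as an element of `C^∞(B)`. -/
noncomputable def testFun (Ω : Set (Euc m)) (w : Euc m → ℝ) (hw : ContDiff ℝ ∞ w) : V Ω :=
  .mk (fun x => w x) w hw fun _ => rfl

/-- Moves integrals to the whole space, where integration by parts has no boundary term. -/
theorem bodyIntegral_eq_integral {w : Euc m → ℝ} (hwΩ : ∀ x ∉ Ω, w x = 0) :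
    bodyIntegral (fun x : closure Ω => w x) = ∫ x, w x := by
  rw [bodyIntegral, integral_subtype_comap isClosed_closure.measurableSet]
  exact setIntegral_eq_integral_of_forall_compl_eq_zero fun x hx =>
    hwΩ x fun h => hx (subset_closure h)

theorem bdryIntegral_testFun (hΩ : IsOpen Ω) (f : BdryFun Ω) {w : Euc m → ℝ}
    (hw : ContDiff ℝ ∞ w) (hwΩ : ∀ x ∉ Ω, w x = 0) : bdryIntegral f (testFun Ω w hw) = 0 := by
  have h : ∀ x : frontier Ω, testFun Ω w hw ⟨x, frontier_subset_closure x.2⟩ = 0 := fun x =>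
    hwΩ x fun hx => x.2.2 (by rwa [hΩ.interior_eq])
  simp [bdryIntegral, h]

/-- The identification of `C^∞(B)` with functionals is determined by test functions. -/
theorem eq_zero_of_bodyIntegral_eq_zero (hΩ : IsOpen Ω) (f : V Ω)
    (h : ∀ (w : Euc m → ℝ) (hw : ContDiff ℝ ∞ w), HasCompactSupport w → tsupport w ⊆ Ω →
      bodyIntegral (fun x => f x * testFun Ω w hw x) = 0) (x : closure Ω) : f x = 0 := by
  rw [← f.ext_apply]
  refine eqOn_zero_of_integral_eq_zero hΩ f.contDiff_ext.continuous (fun w hw hwc hwΩ => ?_) x.2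
  rw [← h w hw hwc hwΩ, ← bodyIntegral_eq_integral (Ω := Ω)]
  · congr 1; funext x; rw [f.ext_apply]; rfl
  · intro x hx
    rw [image_eq_zero_of_notMem_tsupport fun h => hx (hwΩ h), mul_zero]

/-- The covector condition of the canonical Dirac structure in canonical coordinates. -/
theorem canonicalDirac_components (hΩ : IsSmoothBoundedDomain Ω) {z u : RCot Ω} {η : RCotRCot Ω}
    (h : ((z, u), η) ∈ canonicalDirac z) :
    (∀ x, η.2.2 x = u.1 x) ∧ ∀ w, pairing η.2.1 w = -pairing u.2 w := by
  have key : ∀ w : RCot Ω, pairing η.2.1 w.1 + pairing w.2 η.2.2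
      = pairing w.2 u.1 - pairing u.2 w.1 := fun w =>
    (h.2.2 w).trans (symplecticForm_eq hΩ z u w)
  constructor
  · intro x
    have := hΩ.compactSpace_closure
    have hz := eq_zero_of_bodyIntegral_eq_zero hΩ.isOpen (η.2.2 - u.1) (fun w hw hwc hwΩ => ?_) x
    · have : (η.2.2 - u.1) x = η.2.2 x - u.1 x := rfl
      linarith
    -- Varying only the body momentum isolates the `V` component of the covector.
    · have h1 := key (0, (testFun Ω w hw, 0))
      simp only [pairing_eq hΩ, map_zero, zero_mul, zero_add, add_zero,
        mul_zero, sub_zero] at h1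
      have h2 : bodyIntegral (fun x => (η.2.2 - u.1) x * testFun Ω w hw x)
          = bodyC hΩ (toContinuous _ _ (testFun Ω w hw) * toContinuous _ _ η.2.2
            - toContinuous _ _ (testFun Ω w hw) * toContinuous _ _ u.1) := by
        rw [bodyC_apply]
        congr 1; funext y
        change (η.2.2 y - u.1 y) * testFun Ω w hw y
          = testFun Ω w hw y * η.2.2 y - testFun Ω w hw y * u.1 y
        ring
      rw [h2, map_sub, h1, sub_self]
  · intro w
    have h1 := key (w, 0)
    simpa [pairing_zero_left] using h1

/-- `L` is a linear jet map followed by a superposition operator and a bounded integral, so the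
chain rule replaces differentiation under the integral. Taking `a = 0` or `b = 0` gives the two
partial functional derivatives. -/
theorem hasDerivAt_lagrangian (hΩ : IsSmoothBoundedDomain Ω) {𝔏 : ℝ × ℝ × Euc m → ℝ}
    (h𝔏 : ContDiff ℝ ∞ 𝔏) (φ ν a b : V Ω) :
    HasDerivAt (fun ε : ℝ => lagrangian 𝔏 (φ + ε • a, ν + ε • b))
      (bodyIntegral fun x => fderiv ℝ 𝔏 (jet φ ν x) (jet a b x)) 0 := by
  have := hΩ.compactSpace_closure
  have h1 := hasDerivWithinAt_jetC (t := 0) hΩ.isOpen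
    (hasDerivAt_line (toContinuous _ _) φ a).hasDerivWithinAt
    (hasDerivAt_line (toContinuous _ _) ν b).hasDerivWithinAt
    (hasDerivAt_line (gradC hΩ.isOpen) φ a).hasDerivWithinAt (I := univ)
  have h2 := hasDerivWithinAt_superposition (h𝔏.of_le (by simp)) h1
  have h3 := ((bodyC hΩ).hasFDerivAt.comp_hasDerivWithinAt _ h2).hasDerivAt univ_mem
  simp only [zero_smul, add_zero] at h3
  exact h3

theorem grad_zero_apply (hΩ : IsOpen Ω) (x : closure Ω) : grad (0 : V Ω) x = 0 :=
  DFunLike.congr_fun (map_zero (gradC hΩ)) x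

theorem derivNu_lagrangian (hΩ : IsSmoothBoundedDomain Ω) {𝔏 : ℝ × ℝ × Euc m → ℝ}
    (h𝔏 : ContDiff ℝ ∞ 𝔏) (φ ν δ : V Ω) :
    derivNu (lagrangian 𝔏) (φ, ν) δ = bodyIntegral fun x => partialNu 𝔏 (jet φ ν x) * δ x := by
  have h := (hasDerivAt_lagrangian hΩ h𝔏 φ ν 0 δ).deriv
  simp only [smul_zero, add_zero] at h
  rw [derivNu, h]
  congr 1; funext x
  rw [← fderiv_partialNu h𝔏, jet.eq_1 0 δ, grad_zero_apply hΩ.isOpen]; rfl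

theorem derivPhi_lagrangian (hΩ : IsSmoothBoundedDomain Ω) {𝔏 : ℝ × ℝ × Euc m → ℝ}
    (h𝔏 : ContDiff ℝ ∞ 𝔏) (φ ν δ : V Ω) :
    derivPhi (lagrangian 𝔏) (φ, ν) δ = bodyIntegral fun x =>
      fderiv ℝ 𝔏 (jet φ ν x) (1, 0, 0) * δ x
        + inner ℝ (partialGrad 𝔏 (jet φ ν x)) (grad δ x) := by
  have h := (hasDerivAt_lagrangian hΩ h𝔏 φ ν δ 0).deriv
  simp only [smul_zero, add_zero] at h
  rw [derivPhi, h]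
  congr 1; funext x
  rw [jet, jet, fderiv_eq_partials h𝔏, SmoothFun.zero_apply, mul_zero, add_zero]

/-- A jet extended to `ℝᵐ`. -/
noncomputable def jetExt (φ ν : V Ω) (y : Euc m) : ℝ × ℝ × Euc m :=
  (φ.ext y, ν.ext y, gradient φ.ext y)

theorem contDiff_jetExt (φ ν : V Ω) : ContDiff ℝ ∞ (jetExt φ ν) :=
  φ.contDiff_ext.prodMk (ν.contDiff_ext.prodMk (contDiff_gradient φ.contDiff_ext))

theorem jetExt_apply (φ ν : V Ω) (x : closure Ω) : jetExt φ ν x = jet φ ν x := by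
  rw [jetExt, φ.ext_apply, ν.ext_apply]; rfl

/-- Product rule for a scalar times a vector field, once the arbitrary extension of the flux is
replaced by the product of the extended factors. -/
theorem divergence_energyFlux (hΩ : IsOpen Ω) {𝔏 : ℝ × ℝ × Euc m → ℝ} (h𝔏 : ContDiff ℝ ∞ 𝔏)
    (φ ν : V Ω) (x : closure Ω) :
    divergence (energyFlux h𝔏 φ ν) x
      = ν x * divField (fun y => partialGrad 𝔏 (jetExt φ ν y)) x
        + inner ℝ (partialGrad 𝔏 (jet φ ν x)) (grad ν x) := by
  have hG : ContDiff ℝ ∞ fun y => partialGrad 𝔏 (jetExt φ ν y) :=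
    (contDiff_partialGrad h𝔏).comp (contDiff_jetExt φ ν)
  have h1 : fderiv ℝ (energyFlux h𝔏 φ ν).ext x
      = fderiv ℝ (fun y => ν.ext y • partialGrad 𝔏 (jetExt φ ν y)) x :=
    SmoothFun.fderiv_ext_eq hΩ _ (ν.contDiff_ext.smul hG)
      (fun y => by
        change ν.ext y • partialGrad 𝔏 (jetExt φ ν y) = ν y • partialGrad 𝔏 (jet φ ν y)
        rw [jetExt_apply, ν.ext_apply]) x.2
  have h2 := divField_smul (hG.differentiable (by simp) (x : Euc m))
    (ν.contDiff_ext.differentiable (by simp) (x : Euc m))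
  rw [ν.ext_apply, jetExt_apply] at h2
  rw [show grad ν x = gradient ν.ext x from rfl, ← h2, divField, ← h1]; rfl

/-- The Euler–Lagrange equation with body force: the interior part of the momentum balance, when
the latter is tested against all functions in `C^∞(B)`. -/
theorem momentum_balance (hΩ : IsSmoothBoundedDomain Ω) {𝔏 : ℝ × ℝ × Euc m → ℝ}
    (h𝔏 : ContDiff ℝ ∞ 𝔏) (φ ν : V Ω) (a f : RDual Ω)
    (h : ∀ w, pairing a w = derivPhi (lagrangian 𝔏) (φ, ν) w + pairing f w) (x : closure Ω) :
    a.1 x = fderiv ℝ 𝔏 (jet φ ν x) (1, 0, 0)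
      - divField (fun y => partialGrad 𝔏 (jetExt φ ν y)) x + f.1 x := by
  have hJ := contDiff_jetExt φ ν
  have hG : ContDiff ℝ ∞ fun y => partialGrad 𝔏 (jetExt φ ν y) :=
    (contDiff_partialGrad h𝔏).comp hJ
  have hP : ContDiff ℝ ∞ fun y => fderiv ℝ 𝔏 (jetExt φ ν y) (1, 0, 0) :=
    ((h𝔏.fderiv_right (m := ∞) (by simp)).comp hJ).clm_apply contDiff_const
  have hD := contDiff_divField hG
  -- The residual of the equation is formed from extensions to `ℝᵐ`; their values outside `Ω` are
  -- invisible to the test functions.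
  have hz := eqOn_zero_of_integral_eq_zero hΩ.isOpen
    (f := fun y => a.1.ext y - (fderiv ℝ 𝔏 (jetExt φ ν y) (1, 0, 0)
      - divField (fun y => partialGrad 𝔏 (jetExt φ ν y)) y + f.1.ext y))
    (a.1.contDiff_ext.sub ((hP.sub hD).add f.1.contDiff_ext)).continuous
    (fun w hw hwc hwΩ => ?_) x.2
  · have hz' := sub_eq_zero.1 hz
    simpa only [SmoothFun.ext_apply, jetExt_apply] using hz'
  have hw0 : ∀ x ∉ Ω, w x = 0 := fun x hx =>
    image_eq_zero_of_notMem_tsupport fun h => hx (hwΩ h)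
  have hgw0 : ∀ x ∉ Ω, gradient w x = 0 := fun x hx => by
    have : fderiv ℝ w x = 0 := image_eq_zero_of_notMem_tsupport fun h =>
      hx (hwΩ (tsupport_fderiv_subset ℝ h))
    rw [gradient, this, map_zero]
  have hpair : ∀ b : RDual Ω, pairing b (testFun Ω w hw) = ∫ y, b.1.ext y * w y := fun b => by
    rw [pairing, bdryIntegral_testFun hΩ.isOpen _ hw hw0, add_zero,
      ← bodyIntegral_eq_integral (Ω := Ω) fun y hy => by rw [hw0 y hy, mul_zero]]
    congr 1; funext y; rw [b.1.ext_apply]; rfl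
  have hphi : derivPhi (lagrangian 𝔏) (φ, ν) (testFun Ω w hw)
      = ∫ y, (fderiv ℝ 𝔏 (jetExt φ ν y) (1, 0, 0) * w y
        + inner ℝ (partialGrad 𝔏 (jetExt φ ν y)) (gradient w y)) := by
    rw [derivPhi_lagrangian hΩ h𝔏,
      ← bodyIntegral_eq_integral (Ω := Ω) fun y hy => by
        rw [hw0 y hy, hgw0 y hy, mul_zero, inner_zero_right, add_zero]]
    congr 1; funext y
    rw [jetExt_apply, grad_apply_eq hΩ.isOpen (testFun Ω w hw) hw fun _ => rfl]; rfl
  have hint : ∀ {g : Euc m → ℝ}, ContDiff ℝ ∞ g → Integrable fun y => g y * w y := fun hg =>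
    (hg.continuous.mul hw.continuous).integrable_of_hasCompactSupport hwc.mul_left
  have hgc : HasCompactSupport (gradient w) :=
    (hwc.fderiv ℝ).comp_left (map_zero (InnerProductSpace.toDual ℝ (Euc m)).symm)
  have hint' : Integrable fun y => inner ℝ (partialGrad 𝔏 (jetExt φ ν y)) (gradient w y) := by
    refine (hG.continuous.inner (contDiff_gradient hw).continuous).integrable_of_hasCompactSupport
      (hgc.mono fun y hy => ?_)
    exact fun h0 => hy (by simp only [h0, inner_zero_right])
  have hbal := h (testFun Ω w hw)
  rw [hpair, hpair, hphi, integral_add (hint hP) hint', integral_inner_gradient hG hw hwc] at hbal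
  have hsplit : ∀ y, (a.1.ext y - (fderiv ℝ 𝔏 (jetExt φ ν y) (1, 0, 0)
      - divField (fun y => partialGrad 𝔏 (jetExt φ ν y)) y + f.1.ext y)) * w y
      = a.1.ext y * w y - ((fderiv ℝ 𝔏 (jetExt φ ν y) (1, 0, 0) * w y
      - divField (fun y => partialGrad 𝔏 (jetExt φ ν y)) y * w y) + f.1.ext y * w y) :=
    fun y => by ring
  simp only [hsplit]
  have hPD : Integrable fun y => fderiv ℝ 𝔏 (jetExt φ ν y) (1, 0, 0) * w y
      - divField (fun y => partialGrad 𝔏 (jetExt φ ν y)) y * w y := (hint hP).sub (hint hD)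
  have hPDf : Integrable fun y => fderiv ℝ 𝔏 (jetExt φ ν y) (1, 0, 0) * w y
      - divField (fun y => partialGrad 𝔏 (jetExt φ ν y)) y * w y + f.1.ext y * w y :=
    hPD.add (hint f.1.contDiff_ext)
  rw [integral_sub (hint a.1.contDiff_ext) hPDf, integral_add hPD (hint f.1.contDiff_ext),
    integral_sub (hint hP) (hint hD), hbal]
  ring

/-- The Legendre relation: the body momentum is `∂𝔏/∂ν` and the boundary momentum vanishes as a
functional. -/
theorem legendre_relation (hΩ : IsSmoothBoundedDomain Ω) {𝔏 : ℝ × ℝ × Euc m → ℝ}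
    (h𝔏 : ContDiff ℝ ∞ 𝔏) (φ ν : V Ω) (a : RDual Ω)
    (h : pairing a = derivNu (lagrangian 𝔏) (φ, ν)) :
    (∀ x, a.1 x = partialNu 𝔏 (jet φ ν x)) ∧ ∀ w, bdryIntegral a.2 w = 0 := by
  have hN : ContDiff ℝ ∞ fun y => partialNu 𝔏 (jetExt φ ν y) :=
    (contDiff_partialNu h𝔏).comp (contDiff_jetExt φ ν)
  let N : V Ω := .mk (fun x => partialNu 𝔏 (jet φ ν x)) _ hN fun x => by rw [jetExt_apply]
  have hder : ∀ w, derivNu (lagrangian 𝔏) (φ, ν) w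
      = bodyC hΩ (toContinuous _ _ N * toContinuous _ _ w) := derivNu_lagrangian hΩ h𝔏 φ ν
  -- Test functions supported in `Ω` do not see the boundary momentum. Once the body parts agree,
  -- they cancel for every `w`, leaving only the boundary term.
  have hbody : ∀ x, a.1 x = N x := by
    intro x
    have := hΩ.compactSpace_closure
    refine sub_eq_zero.1
      (eq_zero_of_bodyIntegral_eq_zero hΩ.isOpen (a.1 - N) (fun w hw _ hwΩ => ?_) x)
    have h1 := congrFun h (testFun Ω w hw)
    rw [pairing_eq hΩ, ← bdryIntegral_eq, bdryIntegral_testFun hΩ.isOpen _ hw (fun x hx =>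
      image_eq_zero_of_notMem_tsupport fun h => hx (hwΩ h)), add_zero, hder] at h1
    have h2 : bodyIntegral (fun x => (a.1 - N) x * testFun Ω w hw x)
        = bodyC hΩ ((toContinuous _ _ a.1 - toContinuous _ _ N)
          * toContinuous _ _ (testFun Ω w hw)) := rfl
    rw [h2, sub_mul, map_sub, h1, sub_self]
  refine ⟨hbody, fun w => ?_⟩
  have h1 := congrFun h w
  have h2 : toContinuous _ _ a.1 = toContinuous _ _ N := ContinuousMap.ext hbody
  rw [pairing_eq hΩ, ← bdryIntegral_eq, hder, h2] at h1
  linarith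

/-- The equations of motion contained in the Lagrange–Dirac system. -/
theorem lagrangeDirac_equations (hΩ : IsSmoothBoundedDomain Ω) {L : V Ω × V Ω → ℝ}
    {𝓕 : V Ω × V Ω → V Ω} {𝓕b : V Ω × V Ω → BdryFun Ω} {φ ν φ' : V Ω} {a a' : RDual Ω}
    {η : RCotRCot Ω} (hη : toFunctionals η = forcedDiracDifferential L 𝓕 𝓕b (φ, ν))
    (hD : (((φ, a), (φ', a')), η) ∈ canonicalDirac (φ, a)) :
    pairing a = derivNu L (φ, ν) ∧ φ' = ν ∧
      ∀ w, pairing a' w = derivPhi L (φ, ν) w + pairing (𝓕 (φ, ν), 𝓕b (φ, ν)) w := by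
  have h1 : pairing η.1.2 = derivNu L (φ, ν) := congrArg (fun q => q.1.2) hη
  have h2 : pairing η.2.1 = -derivPhi L (φ, ν) - pairing (𝓕 (φ, ν), 𝓕b (φ, ν)) :=
    congrArg (fun q => q.2.1) hη
  have h3 : η.2.2 = ν - 0 := congrArg (fun q => q.2.2) hη
  have hbase : η.1 = (φ, a) := hD.2.1
  obtain ⟨h4, h5⟩ := canonicalDirac_components hΩ hD
  refine ⟨by rw [← h1, hbase], ?_, fun w => ?_⟩
  · rw [sub_zero] at h3
    exact DFunLike.ext _ _ fun x => by rw [← h3]; exact (h4 x).symm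
  · have h6 := h5 w
    rw [h2] at h6
    have h7 : -derivPhi L (φ, ν) w - pairing (𝓕 (φ, ν), 𝓕b (φ, ν)) w = -pairing a' w := h6
    linarith

/-- Along curves of `C^∞(B)` with `φ̇ = ν` and `α = ∂𝔏/∂ν`, the energy density has, uniformly on
`B`, the time derivative `α̇ ν - (∂𝔏/∂φ) ν - (∂𝔏/∂∇φ) · ∇ν`. -/
theorem hasDerivWithinAt_energyDensity [CompactSpace (closure Ω)] (hΩ : IsOpen Ω)
    {𝔏 : ℝ × ℝ × Euc m → ℝ} (h𝔏 : ContDiff ℝ ∞ 𝔏) {φ ν α : ℝ → V Ω} {ν' α' : V Ω} {I : Set ℝ}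
    {t : ℝ} (ht : t ∈ I) (hφ : HasVelocityWithinAt φ (ν t) I t) (hν : HasVelocityWithinAt ν ν' I t)
    (hα : HasVelocityWithinAt α α' I t)
    (hleg : ∀ s ∈ I, ∀ x, α s x = partialNu 𝔏 (jet (φ s) (ν s) x)) :
    ∃ D : C(closure Ω, ℝ), (∀ x, D x = α' x * ν t x
        - (fderiv ℝ 𝔏 (jet (φ t) (ν t) x) (1, 0, 0) * ν t x
          + inner ℝ (partialGrad 𝔏 (jet (φ t) (ν t) x)) (grad (ν t) x))) ∧
      HasDerivWithinAt (fun s => (ContinuousMap.mk _ (contDiff_energyDensity h𝔏).continuous).comp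
        (jetC hΩ (φ s) (ν s))) D I t := by
  have h1 := hasDerivWithinAt_superposition (h𝔏.of_le (by simp))
    (hasDerivWithinAt_jetC hΩ (hφ.hasDerivWithinAt _ continuous_toContinuous)
      (hν.hasDerivWithinAt _ continuous_toContinuous)
      (hφ.hasDerivWithinAt _ (continuous_gradC hΩ)))
  have h2 := (hα.hasDerivWithinAt _ continuous_toContinuous).mul
    (hν.hasDerivWithinAt _ continuous_toContinuous)
  -- Writing the energy as `αν - 𝔏` avoids differentiating `∂𝔏/∂ν` in time: the velocity of `α` is
  -- given. The terms `αν'` and `(∂𝔏/∂ν)ν'` then cancel at time `t`.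
  have hE : ∀ s ∈ I, (ContinuousMap.mk _ (contDiff_energyDensity h𝔏).continuous).comp
        (jetC hΩ (φ s) (ν s)) = toContinuous _ _ (α s) * toContinuous _ _ (ν s)
        - (ContinuousMap.mk _ h𝔏.continuous).comp (jetC hΩ (φ s) (ν s)) := fun s hs => by
    ext1 x
    change energyDensity 𝔏 (jet (φ s) (ν s) x) = α s x * ν s x - 𝔏 (jet (φ s) (ν s) x)
    rw [energyDensity, hleg s hs]; rfl
  refine ⟨_, fun x => ?_, (h2.sub h1).congr hE (hE t ht)⟩
  change α' x * ν t x + α t x * ν' x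
    - fderiv ℝ 𝔏 (jet (φ t) (ν t) x) (ν t x, ν' x, grad (ν t) x) = _
  rw [fderiv_eq_partials h𝔏, hleg t ht]
  ring

/-- The velocity of a curve of boundary momenta which vanish as functionals vanishes as a
functional. -/
theorem bdryIntegral_velocity_eq_zero (hΩ : IsSmoothBoundedDomain Ω) {t₀ t₁ : ℝ} (h : t₀ < t₁)
    {αb : ℝ → BdryFun Ω} {αb' : BdryFun Ω} {t : ℝ} (ht : t ∈ Icc t₀ t₁)
    (hv : HasVelocityWithinAt αb αb' (Icc t₀ t₁) t) (w : V Ω)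
    (h0 : ∀ s ∈ Icc t₀ t₁, bdryIntegral (αb s) w = 0) : bdryIntegral αb' w = 0 := by
  have := hΩ.compactSpace_frontier
  have h1 := (bdryC hΩ).hasFDerivAt.comp_hasDerivWithinAt t
    ((hv.hasDerivWithinAt _ continuous_toContinuous).mul_const (traceC Ω w))
  have h2 : HasDerivWithinAt (fun _ => (0 : ℝ)) (bdryIntegral αb' w) (Icc t₀ t₁) t :=
    h1.congr (fun s hs => (h0 s hs).symm) (h0 t ht).symm
  exact (uniqueDiffOn_Icc h t ht).eq_deriv _ h2 (hasDerivWithinAt_const _ _ _)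

end EnergyBalance

end LagrangeDirac

/-! ### The local and global energy balances. -/

theorem proposition3p15 {m : ℕ} {Ω : Set (LagrangeDirac.Euc m)}
    (hΩ : LagrangeDirac.IsSmoothBoundedDomain Ω)
    {𝔏 : ℝ × ℝ × LagrangeDirac.Euc m → ℝ} (h𝔏 : ContDiff ℝ ∞ 𝔏)
    (𝓕 : LagrangeDirac.V Ω × LagrangeDirac.V Ω → LagrangeDirac.V Ω)
    (𝓕b : LagrangeDirac.V Ω × LagrangeDirac.V Ω → LagrangeDirac.BdryFun Ω)
    (t₀ t₁ : ℝ) (φ ν α : ℝ → LagrangeDirac.V Ω) (αb : ℝ → LagrangeDirac.BdryFun Ω)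
    (hsol : LagrangeDirac.IsLagrangeDiracSolution (LagrangeDirac.lagrangian 𝔏) 𝓕 𝓕b t₀ t₁
      φ ν α αb) :
    (∀ t ∈ Icc t₀ t₁, ∀ x : closure Ω,
      HasDerivWithinAt
        (fun s => LagrangeDirac.energyDensity 𝔏 (LagrangeDirac.jet (φ s) (ν s) x))
        (-(LagrangeDirac.divergence (LagrangeDirac.energyFlux h𝔏 (φ t) (ν t))) x
          + 𝓕 (φ t, ν t) x * ν t x)
        (Icc t₀ t₁) t) ∧
    (∀ t ∈ Icc t₀ t₁,
      HasDerivWithinAt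
        (fun s => LagrangeDirac.bodyIntegral fun x : closure Ω =>
          LagrangeDirac.energyDensity 𝔏 (LagrangeDirac.jet (φ s) (ν s) x))
        (LagrangeDirac.bodyIntegral (fun x : closure Ω => 𝓕 (φ t, ν t) x * ν t x)
          + LagrangeDirac.bdryIntegral (𝓕b (φ t, ν t)) (ν t))
        (Icc t₀ t₁) t) := by
  have := hΩ.compactSpace_closure
  have hleg : ∀ s ∈ Icc t₀ t₁,
      (∀ x, α s x = LagrangeDirac.partialNu 𝔏 (LagrangeDirac.jet (φ s) (ν s) x)) ∧
      ∀ w, LagrangeDirac.bdryIntegral (αb s) w = 0 := fun s hs => by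
    obtain ⟨φ', ν', α', αb', -, -, -, -, η, hη, hD⟩ := hsol s hs
    exact LagrangeDirac.legendre_relation hΩ h𝔏 (φ s) (ν s) (α s, αb s)
      (LagrangeDirac.lagrangeDirac_equations hΩ hη hD).1
  refine ⟨fun t ht x => ?_, fun t ht => ?_⟩
  · obtain ⟨φ', ν', α', αb', hφ, hν, hα, -, η, hη, hD⟩ := hsol t ht
    obtain ⟨-, rfl, hmom⟩ := LagrangeDirac.lagrangeDirac_equations hΩ hη hD
    obtain ⟨D, hDx, hE⟩ := LagrangeDirac.hasDerivWithinAt_energyDensity hΩ.isOpen h𝔏 ht hφ hν hα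
      fun s hs => (hleg s hs).1
    have h1 := (ContinuousMap.evalCLM ℝ x).hasFDerivAt.comp_hasDerivWithinAt t hE
    refine h1.congr_deriv ?_
    -- Substituting for `α'` cancels `(∂𝔏/∂φ)ν`; the terms in `∂𝔏/∂∇φ` combine to minus the
    -- divergence of the flux.
    have h2 := LagrangeDirac.momentum_balance hΩ h𝔏 (φ t) (ν t) (α', αb') _ hmom x
    change D x = _
    rw [hDx, LagrangeDirac.divergence_energyFlux hΩ.isOpen, show α' x = _ from h2]
    ring
  -- On a one-point interval every derivative statement is vacuous. It must be split off because
  -- derivatives are not unique there, so the boundary velocity cannot be shown to vanish.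
  · rcases (ht.1.trans ht.2).eq_or_lt with rfl | hlt
    · exact HasFDerivWithinAt.of_subsingleton (by simp)
    obtain ⟨φ', ν', α', αb', hφ, hν, hα, hαb, η, hη, hD⟩ := hsol t ht
    obtain ⟨-, rfl, hmom⟩ := LagrangeDirac.lagrangeDirac_equations hΩ hη hD
    obtain ⟨D, hDx, hE⟩ := LagrangeDirac.hasDerivWithinAt_energyDensity hΩ.isOpen h𝔏 ht hφ hν hα
      fun s hs => (hleg s hs).1
    have h1 := (LagrangeDirac.bodyC hΩ).hasFDerivAt.comp_hasDerivWithinAt t hE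
    refine h1.congr_deriv ?_
    have hb := LagrangeDirac.bdryIntegral_velocity_eq_zero hΩ hlt ht hαb (ν t)
      fun s hs => (hleg s hs).2 _
    -- The velocity `ν t` is itself an admissible test function, not required to vanish on the
    -- boundary; this produces the power of the boundary force.
    have h2 := hmom (ν t)
    rw [LagrangeDirac.pairing, hb, add_zero, LagrangeDirac.derivPhi_lagrangian hΩ h𝔏] at h2
    -- `R` is the integrand of `δL/δφ` in the direction `ν t`. Defining it as a difference of
    -- continuous functions lets its integral split by linearity.
    let R : C(closure Ω, ℝ) :=
      LagrangeDirac.toContinuous _ _ α' * LagrangeDirac.toContinuous _ _ (ν t) - D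
    have hR : ∀ x, R x = fderiv ℝ 𝔏 (LagrangeDirac.jet (φ t) (ν t) x) (1, 0, 0) * ν t x
        + inner ℝ (LagrangeDirac.partialGrad 𝔏 (LagrangeDirac.jet (φ t) (ν t) x))
          (LagrangeDirac.grad (ν t) x) := fun x => by
      change α' x * ν t x - D x = _
      rw [hDx]; ring
    have h3 : LagrangeDirac.bodyC hΩ R = LagrangeDirac.bodyIntegral (fun x => α' x * ν t x)
        - LagrangeDirac.bodyC hΩ D := map_sub _ _ _
    rw [LagrangeDirac.bodyC_apply, funext hR] at h3
    have h4 : LagrangeDirac.pairing (𝓕 (φ t, ν t), 𝓕b (φ t, ν t)) (ν t)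
      = LagrangeDirac.bodyIntegral (fun x : closure Ω => 𝓕 (φ t, ν t) x * ν t x)
          + LagrangeDirac.bdryIntegral (𝓕b (φ t, ν t)) (ν t) := rfl
    rw [← h4]
    linarith
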